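/- **Proposition 4.2.** All vector spaces are real. For $m\ge 1$ let $\mathcal H_m$ be the vector lattice of continuous positively homogeneous functions $\mathbb R^m\to\mathbb R$, with coordinate projections $\pi_1,\dots,\pi_m\in\mathcal H_m$. If $X$ is a vector lattice with a positively homogeneous continuous function calculus (such as a Banach lattice), then for $h\in\mathcal H_m$ and $x_1,\dots,x_m\in X$ we write $h(x_1,\dots,x_m)=\Phi(h)$, where $\Phi\colon\mathcal H_m\to X$ is the (unique) linear lattice homomorphism with $\Phi(\pi_k)=x_k$ for all $k$. A *convexity condition* is a triple $\mathcal D=(\mathcal G,M,\vartheta)$, where $\mathcal G\subseteq\bigcup_{m\ge1}\mathcal H_m$ is a nonempty set of functions each of which is monotone on the relevant $\mathbb R^m_+$, and $M\colon\mathcal G\to[1,\infty)$ and $\vartheta\colon\mathcal G\to\{0,1\}$ are arbitrary functions. A lattice seminorm $\nu$ on such a vector lattice $X$ is *$\mathcal D$-convex* if for all $m\ge1$ and $g\in\mathcal G\cap\mathcal H_m$, $$\nu\bigl(g(x_1,\dots,x_m)\bigr)\le M(g)\,g\bigl(\nu(x_1),\dots,\nu(x_m)\bigr)$$ for all $x_1,\dots,x_m\in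 X_+$ if $\vartheta(g)=1$, and for all pairwise disjoint $x_1,\dots,x_m\in X_+$ if $\vartheta(g)=0$. A Banach lattice is *$\mathcal D$-convex* if its norm is. Let $E$ be a Banach space with closed dual unit ball $B_{E^*}$, and let $\delta_x\colon B_{E^*}\to\mathbb R$, $\delta_x(x^*)=x^*(x)$, for $x\in E$. Let $$Y_0=\{h(\delta_{x_1},\dots,\delta_{x_m}) : m\ge1,\ h\in\mathcal H_m,\ x_1,\dots,x_m\in E\}\subseteq\mathbb R^{B_{E^*}},$$ a vector lattice under the pointwise operations, with the norm $\|f\|_{\mathcal D}=\sup_\nu\nu(f)$, where $\nu$ ranges over all $\mathcal D$-convex lattice seminorms on $Y_0$ with $\nu(\delta_x)\le\|x\|$ for every $x\in E$. The free $\mathcal D$-convex Banach lattice $\mathrm{FBL}^{\mathcal D}[E]$ is the completion of $(Y_0,\|\cdot\|_{\mathcal D})$, and $\phi_E\colon E\to\mathrm{FBL}^{\mathcal D}[E]$, $\phi_E(x)=\delta_x$, is the canonical linear isometry. Let $\mathcal D$ be a convexity condition, $E$ a Banach space and $C\ge1$ a real number. Then the following are equivalent: 1. $E$ is $C$-isomorphic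 to a complemented subspace of some $\mathcal D$-convex Banach lattice, that is, there are a $\mathcal D$-convex Banach lattice $X$ and bounded linear operators $U\colon E\to X$ and $V\colon X\to E$ with $V\circ U=I_E$ and $\|U\|\,\|V\|\le C$; 2. $\phi_E(E)$ is $C$-complemented in $\mathrm{FBL}^{\mathcal D}[E]$, that is, there is a bounded linear projection of $\mathrm{FBL}^{\mathcal D}[E]$ onto $\phi_E(E)$ of norm at most $C$. -/

import Mathlib

universe u v

noncomputable section

/-! ### Vector lattices, Banach lattices, lattice homomorphisms -/

/-- A Banach lattice: a complete real normed space with a lattice order which is compatible with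
addition and with multiplication by nonnegative scalars, whose norm is a lattice norm
(`|x| ≤ |y|` implies `‖x‖ ≤ ‖y‖`). -/
class IsBanachLattice (X : Type*) [NormedAddCommGroup X] [NormedSpace ℝ X] [Lattice X] : Prop
    extends IsOrderedAddMonoid X, PosSMulMono ℝ X, HasSolidNorm X, CompleteSpace X

/-- A linear map between vector lattices is a (linear) lattice homomorphism. -/
def IsLatticeHom {X Y : Type*} [AddCommGroup X] [Module ℝ X] [Lattice X]
    [AddCommGroup Y] [Module ℝ Y] [Lattice Y] (T : X →ₗ[ℝ] Y) : Prop :=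
  (∀ a b, T (a ⊔ b) = T a ⊔ T b) ∧ ∀ a b, T (a ⊓ b) = T a ⊓ T b

/-- A lattice seminorm. -/
def IsLatticeSeminorm {X : Type*} [AddCommGroup X] [Module ℝ X] [Lattice X]
    (ν : Seminorm ℝ X) : Prop :=
  ∀ x y : X, |x| ≤ |y| → ν x ≤ ν y

/-! ### Positively homogeneous continuous functions and function calculus -/

/-- The space `ℋ_m` of continuous, positively homogeneous, real-valued functions on `ℝ^m`. -/
def posHomFun (m : ℕ) : Submodule ℝ ((Fin m → ℝ) → ℝ) where
  carrier := {h | Continuous h ∧ ∀ c : ℝ, 0 ≤ c → ∀ t, h (c • t) = c * h t}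
  zero_mem' := ⟨continuous_const, fun c _ t => by simp⟩
  add_mem' := fun {f g} hf hg => ⟨hf.1.add hg.1, fun c hc t => by
    simp only [Pi.add_apply, hf.2 c hc t, hg.2 c hc t]; ring⟩
  smul_mem' := fun a f hf => ⟨hf.1.const_smul a, fun c hc t => by
    simp only [Pi.smul_apply, smul_eq_mul, hf.2 c hc t]; ring⟩

/-- `ℋ_m` is a vector lattice under the pointwise operations. -/
instance posHomFun.instLattice (m : ℕ) : Lattice (posHomFun m) :=
  Subtype.lattice
    (fun f g hf hg => ⟨hf.1.sup hg.1, fun c hc t => by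
      simp only [Pi.sup_apply, hf.2 c hc t, hg.2 c hc t]
      exact (mul_max_of_nonneg _ _ hc).symm⟩)
    (fun f g hf hg => ⟨hf.1.inf hg.1, fun c hc t => by
      simp only [Pi.inf_apply, hf.2 c hc t, hg.2 c hc t]
      exact (mul_min_of_nonneg _ _ hc).symm⟩)

/-- The `k`-th coordinate projection `π_k`, as an element of `ℋ_m`. -/
def posHomFun.proj {m : ℕ} (k : Fin m) : posHomFun m :=
  ⟨fun t => t k, continuous_apply k, fun _ _ _ => rfl⟩

/-- `h` is monotone on `ℝ^m_+`. -/
def posHomFun.MonotoneOnPos {m : ℕ} (h : posHomFun m) : Prop :=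
  ∀ t s : Fin m → ℝ, 0 ≤ t → t ≤ s → h.1 t ≤ h.1 s

/-- `Φ : ℋ_m → X` is the function calculus at `x = (x_1, …, x_m)`: a lattice homomorphism with
`Φ π_k = x_k`; then `Φ h` is what is written `h(x_1, …, x_m)`. In a Banach lattice, and in any
finitely uniformly complete Archimedean vector lattice, there is exactly one such `Φ`. -/
def IsFunctionCalculus {X : Type*} [AddCommGroup X] [Module ℝ X] [Lattice X] {m : ℕ}
    (x : Fin m → X) (Φ : posHomFun m →ₗ[ℝ] X) : Prop :=
  IsLatticeHom Φ ∧ ∀ k, Φ (posHomFun.proj k) = x k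

/-! ### Convexity conditions -/

/-- A convexity condition `(𝒢, M, ϑ)`: a nonempty set `𝒢` of continuous positively homogeneous
functions on the spaces `ℝ^m`, `m ≥ 1`, each monotone on `ℝ^m_+`, and arbitrary functions
`M : 𝒢 → [1, ∞)` and `ϑ : 𝒢 → {0, 1}` (`false` is `0` and `true` is `1`). -/
structure ConvexityCondition where
  /-- the set of functions -/
  G : Set (Σ m : ℕ, posHomFun m)
  nonempty : G.Nonempty
  dim_pos : ∀ g ∈ G, 1 ≤ g.1
  monotone : ∀ g ∈ G, posHomFun.MonotoneOnPos g.2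
  /-- the constants -/
  M : G → ℝ
  one_le : ∀ g, 1 ≤ M g
  /-- the switch between disjoint and arbitrary positive elements -/
  theta : G → Bool

/-- A seminorm `ν` on a vector lattice is `𝒟`-convex:
`ν (g(x_1, …, x_m)) ≤ M(g) · g(ν x_1, …, ν x_m)` for all `g ∈ 𝒢_m` and all positive
`x_1, …, x_m`, which are assumed pairwise disjoint if `ϑ(g) = 0`. -/
def IsDConvex (D : ConvexityCondition) {X : Type*} [AddCommGroup X] [Module ℝ X] [Lattice X]
    (ν : Seminorm ℝ X) : Prop :=
  ∀ (m : ℕ) (g : posHomFun m) (hg : (⟨m, g⟩ : Σ m : ℕ, posHomFun m) ∈ D.G) (x : Fin m → X),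
    (∀ i, 0 ≤ x i) →
    (D.theta ⟨_, hg⟩ = false → ∀ i j, i ≠ j → x i ⊓ x j = 0) →
    ∃ Φ : posHomFun m →ₗ[ℝ] X, IsFunctionCalculus x Φ ∧
      ν (Φ g) ≤ D.M ⟨_, hg⟩ * g.1 (fun i => ν (x i))

/-- A Banach lattice is `𝒟`-convex if its norm is. -/
def IsDConvexBanachLattice (D : ConvexityCondition) (X : Type*) [NormedAddCommGroup X]
    [NormedSpace ℝ X] [Lattice X] [IsBanachLattice X] : Prop :=
  IsDConvex D (normSeminorm ℝ X)

/-! ### The free `𝒟`-convex Banach lattice -/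

section Free

variable (E : Type u) [NormedAddCommGroup E] [NormedSpace ℝ E]

/-- The closed unit ball `B_{E^*}` of the dual space. -/
abbrev DualBall : Type u := Metric.closedBall (0 : StrongDual ℝ E) 1

variable {E}

/-- The point evaluation `δ_x : B_{E^*} → ℝ`. -/
def pointEval (x : E) : DualBall E → ℝ := fun xs => xs.1 x

/-- The functions `h(δ_{x_1}, …, δ_{x_m})` on `B_{E^*}`, with `h ∈ ℋ_m` and `x_i ∈ E`. -/
def IsFreeFun (f : DualBall E → ℝ) : Prop :=
  ∃ (m : ℕ) (h : posHomFun m) (x : Fin m → E), f = fun xs => h.1 (fun i => pointEval (x i) xs)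

theorem isFreeFun_pointEval (x : E) : IsFreeFun (pointEval x) :=
  ⟨1, posHomFun.proj 0, fun _ => x, rfl⟩

theorem IsFreeFun.comp {n : ℕ} (k : posHomFun n) {f : Fin n → DualBall E → ℝ}
    (hf : ∀ i, IsFreeFun (f i)) : IsFreeFun (fun xs => k.1 (fun i => f i xs)) := by
  choose m h x hx using hf
  let e := finSigmaFinEquiv (n := m)
  refine ⟨∑ i, m i, ⟨fun t => k.1 (fun i => (h i).1 (fun j => t (e ⟨i, j⟩))), ?_, ?_⟩,
    fun a => x (e.symm a).1 (e.symm a).2, ?_⟩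
  · refine k.2.1.comp (continuous_pi fun i => (h i).2.1.comp (continuous_pi fun j => ?_))
    exact continuous_apply _
  · intro c hc t
    refine Eq.trans (congrArg k.1 (funext fun i => ?_)) (k.2.2 c hc _)
    exact (h i).2.2 c hc (fun j => t (e ⟨i, j⟩))
  · funext xs
    simp only [hx]
    refine congrArg k.1 (funext fun i => congrArg (h i).1 (funext fun j => ?_))
    rw [Equiv.symm_apply_apply]

theorem IsFreeFun.comp₂ (k : posHomFun 2) {f g : DualBall E → ℝ}
    (hf : IsFreeFun f) (hg : IsFreeFun g) : IsFreeFun (fun xs => k.1 ![f xs, g xs]) := by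
  have := IsFreeFun.comp k (f := ![f, g]) (by
    intro i; fin_cases i
    · exact hf
    · exact hg)
  convert this using 3 with xs
  funext i
  fin_cases i <;> rfl

variable (E)

/-- The vector space `Y_0 = {h(δ_{x_1}, …, δ_{x_m})}` of functions on `B_{E^*}`. -/
def freeFun : Submodule ℝ (DualBall E → ℝ) where
  carrier := {f | IsFreeFun f}
  zero_mem' := ⟨0, 0, Fin.elim0, rfl⟩
  add_mem' := fun hf hg => by
    have := IsFreeFun.comp₂ (posHomFun.proj 0 + posHomFun.proj 1) hf hg
    exact this
  smul_mem' := fun a f hf => by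
    have := IsFreeFun.comp₂ (a • posHomFun.proj 0) hf hf
    exact this

/-- The space `Y_0`, as a type of its own (it will carry the `𝒟`-norm). -/
def PreFBL (_D : ConvexityCondition) : Type u := freeFun E

variable (D : ConvexityCondition)

namespace PreFBL

instance : AddCommGroup (PreFBL E D) := inferInstanceAs (AddCommGroup (freeFun E))

instance : Module ℝ (PreFBL E D) := inferInstanceAs (Module ℝ (freeFun E))

/-- `Y_0` is a vector lattice under the pointwise operations. -/
instance : Lattice (PreFBL E D) :=
  Subtype.lattice (P := fun f : DualBall E → ℝ => f ∈ freeFun E)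
    (fun _ _ hf hg => IsFreeFun.comp₂ (posHomFun.proj 0 ⊔ posHomFun.proj 1) hf hg)
    (fun _ _ hf hg => IsFreeFun.comp₂ (posHomFun.proj 0 ⊓ posHomFun.proj 1) hf hg)

variable {E}

/-- The map `x ↦ δ_x` from `E` to `Y_0`. -/
def delta : E →ₗ[ℝ] PreFBL E D where
  toFun x := ⟨pointEval x, isFreeFun_pointEval x⟩
  map_add' x y := Subtype.ext (by funext xs; exact map_add xs.1 x y)
  map_smul' a x := Subtype.ext (by funext xs; exact map_smul xs.1 a x)

variable (E)

/-- The collection `𝒩_𝒟` of all `𝒟`-convex lattice seminorms `ν` on `Y_0` with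
`ν δ_x ≤ ‖x‖` for all `x ∈ E`. -/
def admissible : Set (Seminorm ℝ (PreFBL E D)) :=
  {ν | IsLatticeSeminorm ν ∧ IsDConvex D ν ∧ ∀ x : E, ν (delta D x) ≤ ‖x‖}

variable {E D}

theorem abs_coe (f : PreFBL E D) (xs : DualBall E) : (|f|).1 xs = |f.1 xs| := rfl

/-- Every function in `Y_0` is dominated by a finite sum of functions `|δ_x|`. -/
theorem exists_abs_le (f : PreFBL E D) : ∃ (m : ℕ) (c : ℝ) (x : Fin m → E), 0 ≤ c ∧
    |f| ≤ abs (∑ i, c • |delta D (x i)|) := by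
  obtain ⟨m, h, x, hfx⟩ := f.2
  obtain ⟨c, hc⟩ := (isCompact_closedBall (0 : Fin m → ℝ) 1).exists_bound_of_continuousOn
    h.2.1.continuousOn
  have hc0 : 0 ≤ c := (norm_nonneg _).trans (hc 0 (by simp))
  have key : ∀ t : Fin m → ℝ, |h.1 t| ≤ c * ‖t‖ := by
    intro t
    by_cases ht : ‖t‖ = 0
    · have h0 := h.2.2 0 le_rfl t
      have : t = 0 := norm_eq_zero.1 ht
      subst this
      simp at h0
      simp [h0]
    · have hpos : 0 < ‖t‖ := lt_of_le_of_ne (norm_nonneg _) (Ne.symm ht)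
      have h1 := h.2.2 ‖t‖ hpos.le (‖t‖⁻¹ • t)
      rw [smul_smul, mul_inv_cancel₀ ht, one_smul] at h1
      rw [h1, abs_mul, abs_of_pos hpos, mul_comm]
      gcongr
      apply hc
      simp [norm_smul, inv_mul_cancel₀ ht]
  refine ⟨m, c, x, hc0, fun xs => ?_⟩
  have e1 : (∑ i, c • |delta D (x i)|).1 xs = ∑ i, c * |pointEval (x i) xs| := by
    have : (∑ i, c • |delta D (x i)|).1 = ∑ i, (c • |delta D (x i)|).1 :=
      map_sum (freeFun E).subtype (fun i => c • |delta D (x i)|) Finset.univ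
    rw [this, Finset.sum_apply]
    rfl
  rw [abs_coe, abs_coe, e1, congrFun hfx xs]
  refine (key _).trans ((mul_le_mul_of_nonneg_left ?_ hc0).trans
    ((Finset.mul_sum _ _ _).le.trans (le_abs_self _)))
  rw [pi_norm_le_iff_of_nonneg (Finset.sum_nonneg fun i _ => abs_nonneg _)]
  intro i
  exact Finset.single_le_sum (f := fun i => |pointEval (x i) xs|)
    (fun i _ => abs_nonneg _) (Finset.mem_univ i)

theorem bddAbove_admissible (f : PreFBL E D) :
    BddAbove (Set.range fun ν : admissible E D => ν.1 f) := by
  obtain ⟨m, c, x, hc, hf⟩ := exists_abs_le f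
  refine ⟨∑ i, c * ‖x i‖, ?_⟩
  rintro _ ⟨⟨ν, hν, -, hd⟩, rfl⟩
  refine (hν _ _ hf).trans ((Finset.le_sum_of_subadditive ν (map_zero ν).le (map_add_le_add ν) _ _).trans (Finset.sum_le_sum fun i _ => ?_))
  rw [map_smul_eq_mul, Real.norm_of_nonneg hc]
  refine mul_le_mul_of_nonneg_left ((hν _ _ ?_).trans (hd (x i))) hc
  exact fun xs => by simp only [abs_coe, abs_abs]; exact le_rfl

/-- The evaluation seminorm `f ↦ |f(x^*)|`. -/
def evalSeminorm (xs : DualBall E) : Seminorm ℝ (PreFBL E D) :=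
  Seminorm.of (fun f => |f.1 xs|) (fun f g => abs_add_le (f.1 xs) (g.1 xs))
    (fun a f => abs_mul a (f.1 xs))

theorem evalSeminorm_mem (xs : DualBall E) :
    (evalSeminorm xs : Seminorm ℝ (PreFBL E D)) ∈ admissible E D := by
  refine ⟨fun f g hfg => hfg xs, ?_, fun x => ?_⟩
  · intro m g hg f hf _
    refine ⟨⟨⟨fun h => ⟨fun ys => h.1 (fun i => (f i).1 ys),
      IsFreeFun.comp h (fun i => (f i).2)⟩, fun _ _ => rfl⟩, fun _ _ => rfl⟩,
      ⟨⟨fun _ _ => rfl, fun _ _ => rfl⟩, fun _ => rfl⟩, ?_⟩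
    have hpos : ∀ i, 0 ≤ (f i).1 xs := fun i => hf i xs
    have h0 : 0 ≤ g.1 (fun i => (f i).1 xs) := by
      have h1 := D.monotone _ hg 0 (fun i => (f i).1 xs) le_rfl hpos
      have h2 := g.2.2 0 le_rfl 0
      simp only [smul_zero, zero_mul] at h2
      exact h2 ▸ h1
    change |g.1 (fun i => (f i).1 xs)| ≤ D.M ⟨_, hg⟩ * g.1 (fun i => |(f i).1 xs|)
    simp only [fun i => abs_of_nonneg (hpos i), abs_of_nonneg h0]
    exact le_mul_of_one_le_left h0 (D.one_le _)
  · change |xs.1 x| ≤ ‖x‖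
    have h1 : ‖xs.1‖ ≤ 1 := mem_closedBall_zero_iff.1 xs.2
    exact (xs.1.le_opNorm x).trans (mul_le_of_le_one_left (norm_nonneg x) h1)

instance : Nonempty (admissible E D) :=
  ⟨⟨evalSeminorm ⟨0, by simp⟩, evalSeminorm_mem _⟩⟩

/-- The norm `‖f‖_𝒟 = sup {ν(f) : ν ∈ 𝒩_𝒟}` on `Y_0`. -/
instance : Norm (PreFBL E D) := ⟨fun f => ⨆ ν : admissible E D, ν.1 f⟩

theorem norm_def (f : PreFBL E D) : ‖f‖ = ⨆ ν : admissible E D, ν.1 f := rfl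

theorem le_norm {ν : Seminorm ℝ (PreFBL E D)} (hν : ν ∈ admissible E D) (f : PreFBL E D) :
    ν f ≤ ‖f‖ :=
  le_ciSup (bddAbove_admissible f) ⟨ν, hν⟩

theorem normCore : NormedSpace.Core ℝ (PreFBL E D) where
  norm_nonneg f := Real.iSup_nonneg fun ν => apply_nonneg ν.1 f
  norm_smul a f := by
    simp only [norm_def, map_smul_eq_mul]
    exact (Real.mul_iSup_of_nonneg (norm_nonneg a) _).symm
  norm_triangle f g := ciSup_le fun ν =>
    (map_add_le_add ν.1 f g).trans (add_le_add (le_norm ν.2 f) (le_norm ν.2 g))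
  norm_eq_zero_iff f := by
    constructor
    · intro h
      refine Subtype.ext (funext fun xs => ?_)
      have := le_norm (evalSeminorm_mem xs) f
      rw [h] at this
      exact abs_nonpos_iff.1 this
    · rintro rfl
      simp [norm_def]

instance : NormedAddCommGroup (PreFBL E D) := NormedAddCommGroup.ofCore normCore

instance : NormedSpace ℝ (PreFBL E D) := NormedSpace.ofCore normCore

theorem norm_delta (x : E) : ‖delta D x‖ = ‖x‖ := by
  refine le_antisymm (ciSup_le fun ν => ν.2.2.2 x) ?_
  obtain ⟨g, hg, hgx⟩ := exists_dual_vector'' ℝ x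
  have h := le_norm (evalSeminorm_mem ⟨g, by simpa using hg⟩) (delta D x)
  have h2 : |g x| ≤ ‖delta D x‖ := h
  rw [hgx] at h2
  simpa using h2

end PreFBL

/-- The Banach space underlying the free `𝒟`-convex Banach lattice `FBL^𝒟[E]`: the completion of
`Y_0` for the norm `‖·‖_𝒟`. -/
abbrev FBL : Type u := UniformSpace.Completion (PreFBL E D)

/-- The canonical linear isometry `φ_E : E → FBL^𝒟[E]`, `x ↦ δ_x`. -/
def FBL.phi : E →ₗᵢ[ℝ] FBL E D :=
  (UniformSpace.Completion.toComplₗᵢ (𝕜 := ℝ) (E := PreFBL E D)).comp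
    ⟨PreFBL.delta D, PreFBL.norm_delta⟩

end Free

/-! ### Complementation -/

/-- `F` is `C`-isomorphic to a complemented subspace of `E`: the identity of `F` factors as
`V ∘ U` with bounded operators `U : F → E`, `V : E → F` and `‖U‖ ‖V‖ ≤ C`. -/
def IsIsomorphicToComplemented (C : ℝ) (F E : Type*) [NormedAddCommGroup F] [NormedSpace ℝ F]
    [NormedAddCommGroup E] [NormedSpace ℝ E] : Prop :=
  ∃ (U : F →L[ℝ] E) (V : E →L[ℝ] F), V.comp U = ContinuousLinearMap.id ℝ F ∧ ‖U‖ * ‖V‖ ≤ C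

/-- The subspace `W` of `E` is `C`-complemented in `E`: there is a bounded projection of `E`
onto `W` of norm at most `C`. -/
def IsComplementedWith (C : ℝ) {E : Type*} [NormedAddCommGroup E] [NormedSpace ℝ E]
    (W : Submodule ℝ E) : Prop :=
  ∃ P : E →L[ℝ] W, (∀ w : W, P w = w) ∧ ‖P‖ ≤ C

end

noncomputable section

/-! ### Vector lattices -/

/-! Given `U : E → X` and `V : X → E` with `V U = I`, a lattice homomorphism `T : Y_0 → X` with `T
δ_x = U x` (`PreFBL.exists_latticeHom`) satisfies `‖T f‖ ≤ ‖U‖ ‖f‖`, because `‖U‖⁻¹ ‖T ·‖` is one of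
the seminorms defining the norm (`PreFBL.norm_map_le`). Extending `V T` to the completion and
following it by `φ_E` gives the projection. Conversely `FBL^𝒟[E]` itself serves as `X`; what must be
shown is that it is `𝒟`-convex (`PreFBL.isDConvexBanachLattice_of_denseRange`).

The map `T` is built without assuming a function calculus on `X`. In `Y_0 × X` the pairs `(δ_x, U
x)` generate a vector sublattice, and Hahn–Banach shows that its elements with nonnegative first
component have nonnegative second component. So it is the graph of a lattice homomorphism, which
extends to `Y_0` by relatively uniform limits, the lattice form of Stone–Weierstrass providing the
density. Applied to `E = ℝ^m`, this yields the function calculus of every Banach lattice.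

Convexity survives the supremum over seminorms because each `g` is monotone, and survives completion
because the calculus is continuous. Disjoint tuples are approximated by disjoint ones with a
continuous disjointification that commutes with lattice homomorphisms. -/

theorem inf_eq_add_sub_sup {X : Type*} [AddCommGroup X] [Lattice X] [IsOrderedAddMonoid X]
    (a b : X) : a ⊓ b = a + b - a ⊔ b :=
  eq_sub_of_add_eq (inf_add_sup a b)

/-- Lattice-ordered groups are distributive, so generated sublattices consist of finite infima of
finite suprema. -/
theorem infClosure_supClosure_eq {X : Type*} [AddCommGroup X] [Lattice X] [IsOrderedAddMonoid X]
    (s : Set X) : infClosure (supClosure s) = latticeClosure s := by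
  let := AddCommGroup.toDistribLattice X
  exact infClosure_supClosure s

section VectorLattice

variable {X Y Z : Type*} [AddCommGroup X] [Module ℝ X] [Lattice X]
  [AddCommGroup Y] [Module ℝ Y] [Lattice Y] [AddCommGroup Z] [Module ℝ Z] [Lattice Z]

theorem smul_sup_of_nonneg [PosSMulMono ℝ X] {c : ℝ} (hc : 0 ≤ c) (a b : X) :
    c • (a ⊔ b) = c • a ⊔ c • b := by
  rcases hc.eq_or_lt with rfl | hc
  · simp
  · refine le_antisymm ?_ (sup_le (smul_le_smul_of_nonneg_left le_sup_left hc.le)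
      (smul_le_smul_of_nonneg_left le_sup_right hc.le))
    have hle : ∀ {x y : X}, c • x ≤ y → x ≤ c⁻¹ • y := fun {x y} h => by
      simpa [hc.ne'] using smul_le_smul_of_nonneg_left h (inv_nonneg.2 hc.le)
    have h := smul_le_smul_of_nonneg_left (sup_le (hle (le_sup_left (b := c • b)))
      (hle (le_sup_right (a := c • a)))) hc.le
    rwa [smul_inv_smul₀ hc.ne'] at h

theorem abs_smul_of_nonneg' [PosSMulMono ℝ X] {c : ℝ} (hc : 0 ≤ c) (a : X) :
    |c • a| = c • |a| := by
  rw [abs, abs, smul_sup_of_nonneg hc, smul_neg]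

theorem IsLatticeHom.of_map_sup [IsOrderedAddMonoid X] [IsOrderedAddMonoid Y] {T : X →ₗ[ℝ] Y}
    (hT : ∀ a b, T (a ⊔ b) = T a ⊔ T b) : IsLatticeHom T :=
  ⟨hT, fun a b => by simp only [inf_eq_add_sub_sup, map_sub, map_add, hT]⟩

theorem IsLatticeHom.map_abs {T : X →ₗ[ℝ] Y} (hT : IsLatticeHom T) (a : X) : T |a| = |T a| := by
  rw [abs, abs, hT.1, map_neg]

theorem IsLatticeHom.monotone {T : X →ₗ[ℝ] Y} (hT : IsLatticeHom T) {a b : X} (h : a ≤ b) :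
    T a ≤ T b := by
  rw [← sup_eq_right, ← hT.1, sup_eq_right.2 h]

theorem IsLatticeHom.comp {S : Y →ₗ[ℝ] Z} {T : X →ₗ[ℝ] Y} (hS : IsLatticeHom S)
    (hT : IsLatticeHom T) : IsLatticeHom (S ∘ₗ T) :=
  ⟨fun a b => by simp only [LinearMap.comp_apply, hT.1, hS.1],
    fun a b => by simp only [LinearMap.comp_apply, hT.2, hS.2]⟩

theorem IsFunctionCalculus.comp {m : ℕ} {x : Fin m → X} {Φ : posHomFun m →ₗ[ℝ] X}
    (hΦ : IsFunctionCalculus x Φ) {T : X →ₗ[ℝ] Y} (hT : IsLatticeHom T) :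
    IsFunctionCalculus (fun i => T (x i)) (T ∘ₗ Φ) :=
  ⟨hT.comp hΦ.1, fun k => congrArg T (hΦ.2 k)⟩

variable [IsOrderedAddMonoid X]

/-- Translations commute with `⊔` and `⊓`, so for one fixed summand the good values of the other
form a sublattice; this is used once in each variable. -/
theorem add_mem_latticeClosure (W : Submodule ℝ X) {a b : X}
    (ha : a ∈ latticeClosure (W : Set X)) (hb : b ∈ latticeClosure (W : Set X)) :
    a + b ∈ latticeClosure (W : Set X) := by
  have hL : IsSublattice (latticeClosure (W : Set X)) := isSublattice_latticeClosure
  have h1 : ∀ w ∈ W, w + b ∈ latticeClosure (W : Set X) := by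
    intro w hw
    refine latticeClosure_min (t := {b | w + b ∈ latticeClosure (W : Set X)}) (fun b hb =>
      subset_latticeClosure (W.add_mem hw hb)) ⟨?_, ?_⟩ hb
    · intro x hx y hy
      simpa only [Set.mem_ofPred_eq, add_sup] using hL.supClosed hx hy
    · intro x hx y hy
      simpa only [Set.mem_ofPred_eq, add_inf] using hL.infClosed hx hy
  refine latticeClosure_min (t := {a | a + b ∈ latticeClosure (W : Set X)}) h1 ⟨?_, ?_⟩ ha
  · intro x hx y hy
    simpa only [Set.mem_ofPred_eq, sup_add] using hL.supClosed hx hy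
  · intro x hx y hy
    simpa only [Set.mem_ofPred_eq, inf_add] using hL.infClosed hx hy

variable [PosSMulMono ℝ X]

theorem smul_mem_latticeClosure (W : Submodule ℝ X) (c : ℝ) {a : X}
    (ha : a ∈ latticeClosure (W : Set X)) : c • a ∈ latticeClosure (W : Set X) := by
  have hL : IsSublattice (latticeClosure (W : Set X)) := isSublattice_latticeClosure
  have hneg : ∀ b ∈ latticeClosure (W : Set X), -b ∈ latticeClosure (W : Set X) := by
    intro b hb
    refine latticeClosure_min (t := {b | -b ∈ latticeClosure (W : Set X)}) (fun b hb =>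
      subset_latticeClosure (W.neg_mem hb)) ⟨?_, ?_⟩ hb
    · intro x hx y hy
      simpa only [Set.mem_ofPred_eq, neg_sup] using hL.infClosed hx hy
    · intro x hx y hy
      simpa only [Set.mem_ofPred_eq, neg_inf] using hL.supClosed hx hy
  have hpos : ∀ c : ℝ, 0 ≤ c → c • a ∈ latticeClosure (W : Set X) := by
    intro c hc
    refine latticeClosure_min (t := {b | c • b ∈ latticeClosure (W : Set X)}) (fun b hb =>
      subset_latticeClosure (W.smul_mem c hb)) ⟨?_, ?_⟩ ha
    · intro x hx y hy
      simpa only [Set.mem_ofPred_eq, smul_sup_of_nonneg hc] using hL.supClosed hx hy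
    · intro x hx y hy
      have := hneg _ (hL.supClosed (hneg _ hx) (hneg _ hy))
      rw [← smul_neg, ← smul_neg, ← smul_sup_of_nonneg hc, ← neg_inf, smul_neg, neg_neg] at this
      exact this
  rcases le_total 0 c with hc | hc
  · exact hpos c hc
  · simpa using hneg _ (hpos (-c) (neg_nonneg.2 hc))

/-- The vector sublattice generated by a subspace. -/
def latticeSpan (W : Submodule ℝ X) : Submodule ℝ X where
  carrier := latticeClosure (W : Set X)
  zero_mem' := subset_latticeClosure W.zero_mem
  add_mem' := add_mem_latticeClosure W
  smul_mem' c _ := smul_mem_latticeClosure W c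

theorem le_latticeSpan (W : Submodule ℝ X) : W ≤ latticeSpan W :=
  fun _ h => subset_latticeClosure h

theorem sup_mem_latticeSpan (W : Submodule ℝ X) {a b : X} (ha : a ∈ latticeSpan W)
    (hb : b ∈ latticeSpan W) : a ⊔ b ∈ latticeSpan W :=
  (isSublattice_latticeClosure (s := (W : Set X))).supClosed ha hb

end VectorLattice

/-! ### Extension of lattice homomorphisms by uniform density -/

section Extension

variable {X : Type*} [NormedAddCommGroup X] [NormedSpace ℝ X] [Lattice X] [IsBanachLattice X]

/-- The positive cone is closed, so `ε` may tend to `0`: a Banach lattice is Archimedean. -/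
theorem nonneg_of_forall_neg_smul_le {y w : X} (h : ∀ ε : ℝ, 0 < ε → -(ε • w) ≤ y) : 0 ≤ y := by
  have ht : Filter.Tendsto (fun ε : ℝ => -(ε • w)) (nhdsWithin 0 (Set.Ioi 0)) (nhds 0) := by
    have : Continuous (fun ε : ℝ => -(ε • w)) := by fun_prop
    simpa using (this.tendsto 0).mono_left nhdsWithin_le_nhds
  refine le_of_tendsto ht ?_
  filter_upwards [self_mem_nhdsWithin] with ε hε using h ε hε

theorem eq_of_forall_abs_sub_le_smul {y z w : X} (h : ∀ ε : ℝ, 0 < ε → |y - z| ≤ ε • w) :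
    y = z := by
  have h1 : 0 ≤ y - z := nonneg_of_forall_neg_smul_le (w := w) fun ε hε =>
    neg_le_of_neg_le ((neg_le_abs _).trans (h ε hε))
  have h2 : 0 ≤ z - y := nonneg_of_forall_neg_smul_le (w := w) fun ε hε =>
    neg_le_of_neg_le (by rw [neg_sub]; exact (le_abs_self _).trans (h ε hε))
  exact le_antisymm (sub_nonneg.1 h2) (sub_nonneg.1 h1)

variable {Z : Type*} [AddCommGroup Z] [Module ℝ Z] [Lattice Z] [IsOrderedAddMonoid Z]
  [PosSMulMono ℝ Z]

/-- `(f, y)` is a relatively uniform limit of elements of `G`. -/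
def IsUniformLimit (G : Submodule ℝ (Z × X)) (p : Z × X) : Prop :=
  ∃ q ∈ G, 0 ≤ q ∧ ∀ ε : ℝ, 0 < ε → ∃ s ∈ G, |p - s| ≤ ε • q

theorem abs_mem_of_sup_mem {Y : Type*} [AddCommGroup Y] [Module ℝ Y] [Lattice Y]
    {G : Submodule ℝ Y} (hsup : ∀ a ∈ G, ∀ b ∈ G, a ⊔ b ∈ G) {a : Y} (ha : a ∈ G) : |a| ∈ G :=
  hsup _ ha _ (G.neg_mem ha)

/-- The relatively uniform adherence of a subspace. -/
def uniformAdherence (G : Submodule ℝ (Z × X)) : Submodule ℝ (Z × X) where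
  carrier := {p | IsUniformLimit G p}
  zero_mem' := ⟨0, G.zero_mem, le_rfl, fun ε _ => ⟨0, G.zero_mem, by simp⟩⟩
  add_mem' := by
    rintro p p' ⟨q, hq, hq0, h⟩ ⟨q', hq', hq0', h'⟩
    refine ⟨q + q', G.add_mem hq hq', add_nonneg hq0 hq0', fun ε hε => ?_⟩
    obtain ⟨s, hs, h⟩ := h ε hε
    obtain ⟨s', hs', h'⟩ := h' ε hε
    refine ⟨s + s', G.add_mem hs hs', ?_⟩
    rw [add_sub_add_comm, smul_add]
    exact (abs_add_le _ _).trans (add_le_add h h')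
  smul_mem' := by
    rintro c p ⟨q, hq, hq0, h⟩
    refine ⟨|c| • q, G.smul_mem _ hq, smul_nonneg (abs_nonneg c) hq0, fun ε hε => ?_⟩
    obtain ⟨s, hs, h⟩ := h ε hε
    refine ⟨c • s, G.smul_mem _ hs, ?_⟩
    have habs : |c • (p - s)| = |c| • |p - s| := by
      rcases le_total 0 c with hc | hc
      · rw [abs_smul_of_nonneg' hc, abs_of_nonneg hc]
      · rw [← abs_neg, ← neg_smul, abs_smul_of_nonneg' (neg_nonneg.2 hc), abs_of_nonpos hc]
    rw [← smul_sub, habs, smul_comm]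
    exact smul_le_smul_of_nonneg_left h (abs_nonneg c)

theorem le_uniformAdherence (G : Submodule ℝ (Z × X)) : G ≤ uniformAdherence G :=
  fun p hp => ⟨0, G.zero_mem, le_rfl, fun ε _ => ⟨p, hp, by simp⟩⟩

/-- Birkhoff's inequality `|a ⊔ c - b ⊔ c| ≤ |a - b|` is applied in each variable, and the
regulators add up. -/
theorem sup_mem_uniformAdherence {G : Submodule ℝ (Z × X)} (hsup : ∀ a ∈ G, ∀ b ∈ G, a ⊔ b ∈ G)
    {p p' : Z × X} (hp : p ∈ uniformAdherence G) (hp' : p' ∈ uniformAdherence G) :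
    p ⊔ p' ∈ uniformAdherence G := by
  obtain ⟨q, hq, hq0, h⟩ := hp
  obtain ⟨q', hq', hq0', h'⟩ := hp'
  refine ⟨q + q', G.add_mem hq hq', add_nonneg hq0 hq0', fun ε hε => ?_⟩
  obtain ⟨s, hs, h⟩ := h ε hε
  obtain ⟨s', hs', h'⟩ := h' ε hε
  refine ⟨s ⊔ s', hsup _ hs _ hs', ?_⟩
  calc |p ⊔ p' - s ⊔ s'| = |(p ⊔ p' - s ⊔ p') + (s ⊔ p' - s ⊔ s')| := by
        rw [sub_add_sub_cancel]
    _ ≤ |p ⊔ p' - s ⊔ p'| + |s ⊔ p' - s ⊔ s'| := abs_add_le _ _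
    _ ≤ |p - s| + |p' - s'| := by
        refine add_le_add (abs_sup_sub_sup_le_abs _ _ _) ?_
        rw [sup_comm s, sup_comm s]
        exact abs_sup_sub_sup_le_abs _ _ _
    _ ≤ ε • (q + q') := by rw [smul_add]; exact add_le_add h h'

theorem nonneg_of_mem_uniformAdherence {G : Submodule ℝ (Z × X)}
    (hpos : ∀ p ∈ G, 0 ≤ p.1 → 0 ≤ p.2) {p : Z × X} (hp : p ∈ uniformAdherence G)
    (h0 : 0 ≤ p.1) : 0 ≤ p.2 := by
  obtain ⟨q, hq, hq0, h⟩ := hp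
  -- If `s` approximates `p` up to `ε q`, then `s + ε q` is in `G` with nonnegative first component,
  -- so `p.2 ≥ s.2 - ε q.2 ≥ -2 ε q.2`.
  refine nonneg_of_forall_neg_smul_le (w := (2 : ℝ) • q.2) fun ε hε => ?_
  obtain ⟨s, hs, h⟩ := h ε hε
  have h1 : -(ε • q) ≤ p - s := neg_le_of_neg_le ((neg_le_abs _).trans h)
  have h2 : p - s ≤ ε • q := (le_abs_self _).trans h
  have h3 : 0 ≤ s.2 + ε • q.2 := by
    refine hpos (s + ε • q) (G.add_mem hs (G.smul_mem _ hq)) ?_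
    have : p.1 ≤ s.1 + ε • q.1 := sub_le_iff_le_add'.1 h2.1
    exact h0.trans this
  have h4 : -(ε • q.2) ≤ p.2 - s.2 := h1.2
  have h5 := add_le_add h3 h4
  have h6 : -(ε • q.2) ≤ ε • q.2 + p.2 := by
    calc -(ε • q.2) = 0 + -(ε • q.2) := by abel
      _ ≤ _ := h5
      _ = _ := by abel
  rw [smul_comm, two_smul, neg_add]
  calc -(ε • q.2) + -(ε • q.2) ≤ -(ε • q.2) + (ε • q.2 + p.2) := add_le_add le_rfl h6
    _ = p.2 := by abel

/-- A positive, sup-closed graph whose domain is relatively uniformly dense extends to a lattice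
homomorphism into a Banach lattice. -/
theorem exists_latticeHom_of_graph (G : Submodule ℝ (Z × X))
    (hsup : ∀ a ∈ G, ∀ b ∈ G, a ⊔ b ∈ G) (hpos : ∀ p ∈ G, 0 ≤ p.1 → 0 ≤ p.2)
    (hdense : ∀ f : Z, ∃ q ∈ G, 0 ≤ q.1 ∧ ∀ ε : ℝ, 0 < ε → ∃ s ∈ G, |f - s.1| ≤ ε • q.1) :
    ∃ T : Z →ₗ[ℝ] X, IsLatticeHom T ∧ ∀ p ∈ G, T p.1 = p.2 := by
  -- Positivity applied to both differences makes the adherence the graph of a function.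
  have hinj : ∀ p ∈ uniformAdherence G, ∀ p' ∈ uniformAdherence G, p.1 = p'.1 → p.2 = p'.2 := by
    intro p hp p' hp' h
    refine le_antisymm ?_ ?_ <;> rw [← sub_nonneg]
    · exact nonneg_of_mem_uniformAdherence hpos ((uniformAdherence G).sub_mem hp' hp)
        (sub_nonneg.2 h.le)
    · exact nonneg_of_mem_uniformAdherence hpos ((uniformAdherence G).sub_mem hp hp')
        (sub_nonneg.2 h.ge)
  have habs : ∀ p ∈ G, ∀ q ∈ G, |p.1| ≤ q.1 → |p.2| ≤ q.2 := by
    intro p hp q hq h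
    exact sub_nonneg.1 (hpos (q - |p|) (G.sub_mem hq (abs_mem_of_sup_mem hsup hp))
      (sub_nonneg.2 h))
  -- Approximants of `f` at rate `2⁻ⁿ` have second components that are Cauchy relative to `q.2`,
  -- since `habs` carries order bounds from `Z` to `X`. They converge in norm by completeness, and
  -- the limit keeps the order bounds.
  have htotal : ∀ f : Z, ∃ y : X, (f, y) ∈ uniformAdherence G := by
    intro f
    obtain ⟨q, hq, hq0, h⟩ := hdense f
    choose s hs hfs using fun n : ℕ => h ((1 / 2) ^ n) (by positivity)
    have hq2 : 0 ≤ q.2 := hpos q hq hq0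
    have hsucc : ∀ n k, |(s n).2 - (s (n + k)).2| ≤ (2 * (1 / 2 : ℝ) ^ n) • q.2 := by
      intro n k
      refine habs (s n - s (n + k)) (G.sub_mem (hs _) (hs _)) ((2 * (1 / 2 : ℝ) ^ n) • q)
        (G.smul_mem _ hq) ?_
      calc |(s n).1 - (s (n + k)).1| = |((s n).1 - f) + (f - (s (n + k)).1)| := by
            rw [sub_add_sub_cancel]
        _ ≤ |(s n).1 - f| + |f - (s (n + k)).1| := abs_add_le _ _
        _ ≤ ((1 / 2 : ℝ) ^ n) • q.1 + ((1 / 2 : ℝ) ^ n) • q.1 := by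
            rw [abs_sub_comm]
            refine add_le_add (hfs n) ((hfs (n + k)).trans ?_)
            refine smul_le_smul_of_nonneg_right ?_ hq0
            exact pow_le_pow_of_le_one (by norm_num) (by norm_num) (Nat.le_add_right n k)
        _ = (2 * (1 / 2 : ℝ) ^ n) • q.1 := by rw [← add_smul, two_mul]
    have hcauchy : CauchySeq fun n => (s n).2 := by
      refine cauchySeq_of_le_geometric (1 / 2) (2 * ‖q.2‖) (by norm_num) fun n => ?_
      have h1 := norm_le_norm_of_abs_le_abs ((hsucc n 1).trans (le_abs_self _))
      rw [norm_smul, Real.norm_of_nonneg (by positivity)] at h1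
      rw [dist_eq_norm]
      linarith
    obtain ⟨y, hy⟩ := cauchySeq_tendsto_of_complete hcauchy
    have hlim : ∀ n, |(s n).2 - y| ≤ (2 * (1 / 2 : ℝ) ^ n) • q.2 := by
      intro n
      have h1 : Filter.Tendsto (fun k => |(s n).2 - (s (n + k)).2|) Filter.atTop
          (nhds |(s n).2 - y|) := by
        have h2 : Filter.Tendsto (fun k => (s (n + k)).2) Filter.atTop (nhds y) := by
          simpa only [add_comm n] using (Filter.tendsto_add_atTop_iff_nat n).2 hy
        have h3 := tendsto_const_nhds (x := (s n).2) (f := Filter.atTop (α := ℕ)) |>.sub h2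
        exact h3.sup_nhds h3.neg
      exact le_of_tendsto' h1 (hsucc n)
    refine ⟨y, (2 : ℝ) • q, G.smul_mem _ hq,
      ⟨smul_nonneg zero_le_two hq0, smul_nonneg zero_le_two hq2⟩, fun ε hε => ?_⟩
    obtain ⟨n, hn⟩ := exists_pow_lt_of_lt_one hε (by norm_num : (1 / 2 : ℝ) < 1)
    refine ⟨s n, hs n, ?_, ?_⟩
    · change |f - (s n).1| ≤ ε • (2 : ℝ) • q.1
      refine (hfs n).trans ?_
      rw [smul_smul]
      exact smul_le_smul_of_nonneg_right (by linarith) hq0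
    · change |y - (s n).2| ≤ ε • (2 : ℝ) • q.2
      rw [abs_sub_comm]
      refine (hlim n).trans ?_
      rw [smul_smul]
      exact smul_le_smul_of_nonneg_right (by linarith) hq2
  choose T hT using htotal
  have hTeq : ∀ p ∈ uniformAdherence G, T p.1 = p.2 := fun p hp => hinj _ (hT p.1) p hp rfl
  refine ⟨⟨⟨T, fun f g => ?_⟩, fun c f => ?_⟩, IsLatticeHom.of_map_sup fun f g => ?_, fun p hp =>
    hTeq p (le_uniformAdherence G hp)⟩
  · exact hTeq _ ((uniformAdherence G).add_mem (hT f) (hT g))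
  · exact hTeq _ ((uniformAdherence G).smul_mem c (hT f))
  · exact hTeq _ (sup_mem_uniformAdherence hsup (hT f) (hT g))

end Extension

end

noncomputable section

/-! ### Density of lattice-linear functions and uniqueness of the function calculus -/

namespace posHomFun

variable {m : ℕ}

instance : IsOrderedAddMonoid (posHomFun m) where
  add_le_add_left _ _ h c t := add_le_add_left (h t) (c.1 t)

instance : PosSMulMono ℝ (posHomFun m) where
  smul_le_smul_of_nonneg_left _ hc _ _ h t := mul_le_mul_of_nonneg_left (h t) hc

/-- The function `t ↦ ∑ |t_k|`. -/
def sumAbs (m : ℕ) : posHomFun m := ∑ k, |proj k|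

theorem sumAbs_apply (t : Fin m → ℝ) : (sumAbs m).1 t = ∑ k, |t k| := by
  have : (sumAbs m).1 = ∑ k, (|proj k| : posHomFun m).1 :=
    map_sum (posHomFun m).subtype _ Finset.univ
  rw [this, Finset.sum_apply]
  rfl

theorem apply_zero (h : posHomFun m) : h.1 0 = 0 := by
  simpa using h.2.2 0 le_rfl 0

theorem isCompact_sumAbs_eq_one (m : ℕ) :
    IsCompact {t : Fin m → ℝ | (sumAbs m).1 t = 1} := by
  refine (isCompact_closedBall (0 : Fin m → ℝ) 1).of_isClosed_subset
    (isClosed_eq (sumAbs m).2.1 continuous_const) fun t ht => ?_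
  rw [mem_closedBall_zero_iff, pi_norm_le_iff_of_nonneg zero_le_one]
  intro k
  have h1 : ∑ k, |t k| = 1 := (sumAbs_apply t).symm.trans ht
  rw [← h1]
  exact Finset.single_le_sum (f := fun k => |t k|) (fun k _ => abs_nonneg _) (Finset.mem_univ k)

/-- Every continuous positively homogeneous function is a relatively uniform limit of elements of
any vector sublattice containing the coordinate projections. -/
theorem exists_mem_abs_sub_le (S : Submodule ℝ (posHomFun m))
    (hsup : ∀ a ∈ S, ∀ b ∈ S, a ⊔ b ∈ S) (hproj : ∀ k, proj k ∈ S) (h : posHomFun m) {ε : ℝ}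
    (hε : 0 < ε) : ∃ s ∈ S, |h - s| ≤ ε • sumAbs m := by
  have hN : sumAbs m ∈ S := S.sum_mem fun k _ => abs_mem_of_sup_mem hsup (hproj k)
  have hinf : ∀ a ∈ S, ∀ b ∈ S, a ⊓ b ∈ S := fun a ha b hb => by
    rw [inf_eq_add_sub_sup]
    exact S.sub_mem (S.add_mem ha hb) (hsup a ha b hb)
  -- By homogeneity it suffices to approximate on the `ℓ¹` unit sphere, where `sumAbs` is the
  -- constant `1` and the lattice Stone–Weierstrass theorem applies.
  let K : Set (Fin m → ℝ) := {t | (sumAbs m).1 t = 1}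
  have : CompactSpace K := isCompact_iff_compactSpace.1 (isCompact_sumAbs_eq_one m)
  let r : posHomFun m → C(K, ℝ) := fun s => ⟨fun t => s.1 t, s.2.1.comp continuous_subtype_val⟩
  have hclos : closure (r '' S) = ⊤ := by
    refine ContinuousMap.sublattice_closure_eq_top _ ⟨_, 0, S.zero_mem, rfl⟩ ?_ ?_ ?_
    · rintro _ ⟨a, ha, rfl⟩ _ ⟨b, hb, rfl⟩
      exact ⟨a ⊓ b, hinf a ha b hb, rfl⟩
    · rintro _ ⟨a, ha, rfl⟩ _ ⟨b, hb, rfl⟩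
      exact ⟨a ⊔ b, hsup a ha b hb, rfl⟩
    · intro v x y
      have key : ∃ s ∈ S, s.1 x = v x ∧ s.1 y = v y := by
        have hx1 : (sumAbs m).1 x = 1 := x.2
        have hy1 : (sumAbs m).1 y = 1 := y.2
        by_cases hxy : x = y
        · subst hxy
          refine ⟨v x • sumAbs m, S.smul_mem _ hN, ?_, ?_⟩ <;>
          · change v x * (sumAbs m).1 x = v x
            rw [hx1, mul_one]
        · obtain ⟨k, hk⟩ := Function.ne_iff.1 (fun h => hxy (Subtype.ext h))
          have hk' := sub_ne_zero.2 hk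
          -- Affine interpolation in a coordinate separating `x` and `y`, with `sumAbs` as the
          -- constant function.
          set a := (v x - v y) / (x.1 k - y.1 k) with ha
          refine ⟨a • proj k + (v x - a * x.1 k) • sumAbs m,
            S.add_mem (S.smul_mem _ (hproj k)) (S.smul_mem _ hN), ?_, ?_⟩
          · change a * x.1 k + (v x - a * x.1 k) * (sumAbs m).1 x = v x
            rw [hx1]; ring
          · change a * y.1 k + (v x - a * x.1 k) * (sumAbs m).1 y = v y
            have : a * (x.1 k - y.1 k) = v x - v y := div_mul_cancel₀ _ hk'
            rw [hy1]; linarith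
      obtain ⟨s, hs, h1, h2⟩ := key
      exact ⟨_, ⟨s, hs, rfl⟩, h1, h2⟩
  have hr : r h ∈ closure (r '' S) := by rw [hclos]; trivial
  obtain ⟨_, ⟨s, hs, rfl⟩, hd⟩ := Metric.mem_closure_iff.1 hr ε hε
  refine ⟨s, hs, fun t => ?_⟩
  change |h.1 t - s.1 t| ≤ ε * (sumAbs m).1 t
  have hc0 : 0 ≤ (sumAbs m).1 t := by
    rw [sumAbs_apply]; exact Finset.sum_nonneg fun k _ => abs_nonneg _
  rcases hc0.eq_or_lt with hc | hc
  · have ht : t = 0 := by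
      rw [sumAbs_apply] at hc
      funext k
      exact abs_eq_zero.1 ((Finset.sum_eq_zero_iff_of_nonneg fun k _ => abs_nonneg (t k)).1 hc.symm
        k (Finset.mem_univ k))
    rw [ht, apply_zero, apply_zero, apply_zero]
    simp
  · set c := (sumAbs m).1 t
    have hK : (sumAbs m).1 (c⁻¹ • t) = 1 := by
      rw [(sumAbs m).2.2 _ (inv_nonneg.2 hc0)]
      exact inv_mul_cancel₀ hc.ne'
    have h1 := (ContinuousMap.dist_apply_le_dist (f := r h) (g := r s) ⟨c⁻¹ • t, hK⟩).trans hd.le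
    have h2 : |h.1 (c⁻¹ • t) - s.1 (c⁻¹ • t)| ≤ ε := h1
    rw [h.2.2 _ (inv_nonneg.2 hc0), s.2.2 _ (inv_nonneg.2 hc0), ← mul_sub, abs_mul,
      abs_of_pos (inv_pos.2 hc), inv_mul_le_iff₀ hc, mul_comm] at h2
    exact h2

end posHomFun

section Uniqueness

variable {X : Type*} [NormedAddCommGroup X] [NormedSpace ℝ X] [Lattice X]
  {m : ℕ} {x : Fin m → X} {Φ Ψ : posHomFun m →ₗ[ℝ] X}

theorem IsFunctionCalculus.map_sumAbs (hΦ : IsFunctionCalculus x Φ) :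
    Φ (posHomFun.sumAbs m) = ∑ k, |x k| := by
  rw [posHomFun.sumAbs, map_sum]
  exact Finset.sum_congr rfl fun k _ => by rw [hΦ.1.map_abs, hΦ.2]

theorem IsFunctionCalculus.abs_map_sub_le (hΦ : IsFunctionCalculus x Φ) {h s : posHomFun m}
    {ε : ℝ} (hs : |h - s| ≤ ε • posHomFun.sumAbs m) : |Φ h - Φ s| ≤ ε • ∑ k, |x k| := by
  have := hΦ.1.monotone hs
  rwa [hΦ.1.map_abs, map_sub, map_smul, hΦ.map_sumAbs] at this

/-- The functions on which two calculi agree form a vector sublattice containing the projections,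
hence a uniformly dense one. -/
theorem IsFunctionCalculus.unique [IsBanachLattice X] (hΦ : IsFunctionCalculus x Φ) (hΨ : IsFunctionCalculus x Ψ) :
    Φ = Ψ := by
  ext h
  refine eq_of_forall_abs_sub_le_smul (w := (2 : ℝ) • ∑ k, |x k|) fun ε hε => ?_
  obtain ⟨s, hs, hhs⟩ := posHomFun.exists_mem_abs_sub_le (LinearMap.eqLocus Φ Ψ)
    (fun a ha b hb => by
      rw [LinearMap.mem_eqLocus] at *
      rw [hΦ.1.1, hΨ.1.1, ha, hb])
    (fun k => (hΦ.2 k).trans (hΨ.2 k).symm) h hε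
  have hs' : Φ s = Ψ s := hs
  calc |Φ h - Ψ h| = |(Φ h - Φ s) + (Ψ s - Ψ h)| := by rw [hs', sub_add_sub_cancel]
    _ ≤ |Φ h - Φ s| + |Ψ s - Ψ h| := abs_add_le _ _
    _ ≤ ε • ∑ k, |x k| + ε • ∑ k, |x k| := by
        rw [abs_sub_comm (Ψ s)]
        exact add_le_add (hΦ.abs_map_sub_le hhs) (hΨ.abs_map_sub_le hhs)
    _ = ε • (2 : ℝ) • ∑ k, |x k| := by rw [two_smul, smul_add]

end Uniqueness

/-! ### The lattice `Y_0` and its universal property -/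

namespace PreFBL

variable {E : Type u} [NormedAddCommGroup E] [NormedSpace ℝ E] {D : ConvexityCondition}

instance : IsOrderedAddMonoid (PreFBL E D) where
  add_le_add_left _ _ h c t := add_le_add_left (h t) (c.1 t)

instance : PosSMulMono ℝ (PreFBL E D) where
  smul_le_smul_of_nonneg_left _ hc _ _ h t := mul_le_mul_of_nonneg_left (h t) hc

/-- The pointwise function calculus on `Y_0`. -/
def calculus {m : ℕ} (f : Fin m → PreFBL E D) : posHomFun m →ₗ[ℝ] PreFBL E D where
  toFun h := ⟨fun xs => h.1 fun i => (f i).1 xs, IsFreeFun.comp h fun i => (f i).2⟩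
  map_add' _ _ := rfl
  map_smul' _ _ := rfl

theorem isFunctionCalculus_calculus {m : ℕ} (f : Fin m → PreFBL E D) :
    IsFunctionCalculus f (calculus f) :=
  ⟨⟨fun _ _ => rfl, fun _ _ => rfl⟩, fun _ => rfl⟩

theorem exists_calculus_delta_eq (f : PreFBL E D) : ∃ (m : ℕ) (h : posHomFun m) (x : Fin m → E),
    calculus (fun i => delta D (x i)) h = f := by
  obtain ⟨m, h, x, hf⟩ := f.2
  exact ⟨m, h, x, Subtype.ext hf.symm⟩

variable {X : Type*} [NormedAddCommGroup X] [NormedSpace ℝ X] [Lattice X] [IsBanachLattice X]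

/-- If a finite supremum of elements `(δ_x, U x)` has nonnegative first component, then its second
component is nonnegative: `0` is a convex combination of the vectors `x` involved. -/
theorem nonneg_of_mem_supClosure (U : E →ₗ[ℝ] X) {p : PreFBL E D × X}
    (hp : p ∈ supClosure (LinearMap.range ((delta D).prod U) : Set (PreFBL E D × X)))
    (h0 : 0 ≤ p.1) : 0 ≤ p.2 := by
  obtain ⟨t, ht, hts, rfl⟩ := hp
  choose! x hx using fun q (hq : q ∈ t) => hts hq
  have hle : ∀ q ∈ t, U (x q) ≤ (t.sup' ht id).2 := fun q hq => by
    have h1 : q ≤ t.sup' ht id := Finset.le_sup' id hq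
    have h2 := h1.2
    rwa [← hx q hq] at h2
  -- Otherwise a functional is negative at all these vectors; scaled into the dual ball, it is a
  -- point where the supremum of the `δ_x` is negative.
  have hzero : (0 : E) ∈ convexHull ℝ (x '' (t : Set (PreFBL E D × X))) := by
    by_contra hnot
    have hcomp : IsCompact (convexHull ℝ (x '' (t : Set (PreFBL E D × X)))) :=
      ((t.finite_toSet).image x).isCompact_convexHull ℝ
    obtain ⟨f, a, b, hfa, hab, hb⟩ := geometric_hahn_banach_compact_closed
      (convex_convexHull ℝ _) hcomp (convex_singleton (0 : E)) isClosed_singleton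
      (Set.disjoint_singleton_right.2 hnot)
    have hneg : ∀ q ∈ t, f (x q) < 0 := fun q hq =>
      (hfa _ (subset_convexHull ℝ _ ⟨q, hq, rfl⟩)).trans (hab.trans (by simpa using hb 0 rfl))
    let c : ℝ := (‖f‖ + 1)⁻¹
    have hc : 0 < c := by positivity
    have hmem : c • f ∈ Metric.closedBall (0 : StrongDual ℝ E) 1 := by
      rw [mem_closedBall_zero_iff, norm_smul, Real.norm_of_nonneg hc.le, inv_mul_le_iff₀]
      · linarith
      · positivity
    let xs : DualBall E := ⟨c • f, hmem⟩
    have hlt : (t.sup' ht id).1.1 xs < 0 := by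
      refine Finset.sup'_induction ht id (p := fun q : PreFBL E D × X => q.1.1 xs < 0)
        (fun a ha b hb => max_lt ha hb) fun q hq => ?_
      change q.1.1 xs < 0
      rw [← hx q hq]
      exact mul_neg_of_pos_of_neg hc (hneg q hq)
    exact absurd (h0 xs) (not_le.2 hlt)
  -- The preimage of an order interval `Iic` under a linear map is convex, so the upper bound for
  -- the `U x` is also one for `U 0 = 0`.
  have hsub : convexHull ℝ (x '' (t : Set (PreFBL E D × X))) ⊆ U ⁻¹' Set.Iic (t.sup' ht id).2 := by
    refine convexHull_min ?_ ((convex_Iic ((t.sup' ht id).2)).linear_preimage U)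
    rintro _ ⟨q, hq, rfl⟩
    exact hle q hq
  simpa using hsub hzero

/-- If an infimum has nonnegative first component, so do all its terms; this reduces the claim to
suprema. -/
theorem nonneg_of_mem_latticeSpan (U : E →ₗ[ℝ] X) {p : PreFBL E D × X}
    (hp : p ∈ latticeSpan (LinearMap.range ((delta D).prod U))) (h0 : 0 ≤ p.1) : 0 ≤ p.2 := by
  have hp' : p ∈ infClosure (supClosure
      (LinearMap.range ((delta D).prod U) : Set (PreFBL E D × X))) := by
    rw [infClosure_supClosure_eq]
    exact hp
  obtain ⟨t, ht, hts, rfl⟩ := hp'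
  have : ((t.inf' ht id).1, (0 : X)) ≤ t.inf' ht id := by
    refine Finset.le_inf' _ _ fun q hq => ?_
    have h1 : t.inf' ht id ≤ q := Finset.inf'_le id hq
    exact ⟨h1.1, nonneg_of_mem_supClosure U (hts hq) (h0.trans h1.1)⟩
  exact this.2

/-- Every linear map from `E` to a Banach lattice extends to a lattice homomorphism on `Y_0`. -/
theorem exists_latticeHom (D : ConvexityCondition) (U : E →ₗ[ℝ] X) :
    ∃ T : PreFBL E D →ₗ[ℝ] X, IsLatticeHom T ∧ ∀ x, T (delta D x) = U x := by
  set W := LinearMap.range ((delta D).prod U)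
  have hmem : ∀ x, (delta D x, U x) ∈ latticeSpan W := fun x => le_latticeSpan W ⟨x, rfl⟩
  obtain ⟨T, hT, hTG⟩ := exists_latticeHom_of_graph (latticeSpan W)
    (fun a ha b hb => sup_mem_latticeSpan W ha hb)
    (fun p hp h0 => nonneg_of_mem_latticeSpan U hp h0) (by
      intro f
      obtain ⟨m, h, x, rfl⟩ := exists_calculus_delta_eq f
      set Φ := calculus (D := D) fun i => delta D (x i)
      have hΦ : IsFunctionCalculus (fun i => delta D (x i)) Φ := isFunctionCalculus_calculus _
      -- Those `h` whose value at the `δ_{x_i}` lies in the domain of the graph: a vector sublattice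
      -- containing the projections, hence uniformly dense.
      set S := ((latticeSpan W).map (LinearMap.fst ℝ (PreFBL E D) X)).comap Φ
      have hSsup : ∀ a ∈ S, ∀ b ∈ S, a ⊔ b ∈ S := by
        rintro a ⟨p, hp, hpa⟩ b ⟨q, hq, hqb⟩
        refine ⟨p ⊔ q, sup_mem_latticeSpan W hp hq, ?_⟩
        rw [hΦ.1.1, ← hpa, ← hqb]
        rfl
      have hSproj : ∀ k, posHomFun.proj k ∈ S := fun k => ⟨_, hmem (x k), (hΦ.2 k).symm⟩
      obtain ⟨q, hq, hqN⟩ : posHomFun.sumAbs m ∈ S :=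
        S.sum_mem fun k _ => abs_mem_of_sup_mem hSsup (hSproj k)
      have hqN : q.1 = Φ (posHomFun.sumAbs m) := hqN
      refine ⟨q, hq, ?_, fun ε hε => ?_⟩
      · rw [hqN]
        intro xs
        change (0 : ℝ) ≤ (posHomFun.sumAbs m).1 _
        rw [posHomFun.sumAbs_apply]
        exact Finset.sum_nonneg fun k _ => abs_nonneg _
      · obtain ⟨s, ⟨p, hp, hps⟩, hs⟩ := posHomFun.exists_mem_abs_sub_le S hSsup hSproj h hε
        have hps : p.1 = Φ s := hps
        refine ⟨p, hp, ?_⟩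
        have := hΦ.1.monotone hs
        rwa [hΦ.1.map_abs, map_sub, map_smul, ← hps, ← hqN] at this)
  exact ⟨T, hT, fun x => hTG _ (hmem x)⟩

end PreFBL

/-! ### The function calculus on a Banach lattice -/

section Calculus

variable {X : Type*} [NormedAddCommGroup X] [NormedSpace ℝ X] [Lattice X] [IsBanachLattice X]
  {m : ℕ}

/-- The convexity condition with the single function `t ↦ t` on `ℝ`, satisfied by every norm. -/
def trivialConvexityCondition : ConvexityCondition where
  G := {⟨1, posHomFun.proj 0⟩}
  nonempty := Set.singleton_nonempty _
  dim_pos := by rintro _ rfl; exact le_rfl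
  monotone := by rintro _ rfl t s _ h; exact h 0
  M _ := 1
  one_le _ := le_rfl
  theta _ := true

/-- The linear map `e_k ↦ x_k` on `ℝ^m` extends to a lattice homomorphism on the corresponding
`Y_0`; composing it with the pointwise calculus at the `δ_{e_k}` gives `Φ`. Any convexity condition
would do, as the lattice `Y_0` does not depend on it. -/
theorem exists_isFunctionCalculus (x : Fin m → X) :
    ∃ Φ : posHomFun m →ₗ[ℝ] X, IsFunctionCalculus x Φ := by
  obtain ⟨T, hT, hTx⟩ :=
    PreFBL.exists_latticeHom trivialConvexityCondition (Fintype.linearCombination ℝ x)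
  refine ⟨_, hT.comp (PreFBL.isFunctionCalculus_calculus fun i =>
    PreFBL.delta trivialConvexityCondition (Pi.single i (1 : ℝ) : Fin m → ℝ)).1, fun k => ?_⟩
  refine (hTx (Pi.single k 1)).trans ?_
  simp

/-- The function calculus at a tuple of elements of a Banach lattice. -/
def functionCalculus (x : Fin m → X) : posHomFun m →ₗ[ℝ] X :=
  (exists_isFunctionCalculus x).choose

theorem isFunctionCalculus_functionCalculus (x : Fin m → X) :
    IsFunctionCalculus x (functionCalculus x) :=
  (exists_isFunctionCalculus x).choose_spec

/-- The `h` with this property form a vector sublattice containing the projections, and the error of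
approximating a general `h` from it is at most `ε ∑ ‖y_k‖`, so it is uniform on bounded sets. -/
theorem continuous_functionCalculus (h : posHomFun m) :
    Continuous fun x : Fin m → X => functionCalculus x h := by
  have hc := isFunctionCalculus_functionCalculus (X := X) (m := m)
  let S : Submodule ℝ (posHomFun m) :=
    { carrier := {h | Continuous fun x : Fin m → X => functionCalculus x h}
      zero_mem' := by simpa using continuous_const
      add_mem' := fun ha hb => by
        simp only [Set.mem_ofPred_eq, map_add] at *
        exact ha.add hb
      smul_mem' := fun c a ha => by
        simp only [Set.mem_ofPred_eq, map_smul] at *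
        exact ha.const_smul c }
  refine continuous_of_locally_uniform_approx_of_continuousAt fun x u hu => ?_
  obtain ⟨δ, hδ, hu⟩ := Metric.mem_uniformity_dist.1 hu
  -- Adding `1` makes `∑ ‖y_k‖ < R` an open neighbourhood of `x` and keeps `R` positive.
  set R : ℝ := (∑ k, ‖x k‖) + 1
  have hR : 0 < R := by positivity
  obtain ⟨s, hs, hhs⟩ := posHomFun.exists_mem_abs_sub_le S
    (fun a ha b hb => by
      have ha : Continuous fun x : Fin m → X => functionCalculus x a := ha
      have hb : Continuous fun x : Fin m → X => functionCalculus x b := hb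
      change Continuous fun x : Fin m → X => functionCalculus x (a ⊔ b)
      simp only [fun x => (hc x).1.1]
      exact ha.sup hb)
    (fun k => by
      change Continuous fun x : Fin m → X => functionCalculus x (posHomFun.proj k)
      simp only [fun x => (hc x).2]
      exact continuous_apply k) h (div_pos hδ hR)
  have hopen : IsOpen {y : Fin m → X | ∑ k, ‖y k‖ < R} :=
    isOpen_lt (by fun_prop) continuous_const
  have hx : x ∈ {y : Fin m → X | ∑ k, ‖y k‖ < R} := lt_add_one (∑ k, ‖x k‖)
  refine ⟨_, hopen.mem_nhds hx, fun y => functionCalculus y s,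
    Continuous.continuousAt hs, fun y hy => hu ?_⟩
  have h1 := norm_le_norm_of_abs_le_abs
    (((hc y).abs_map_sub_le hhs).trans (le_abs_self _))
  rw [dist_eq_norm]
  calc ‖functionCalculus y h - functionCalculus y s‖ ≤ ‖(δ / R) • ∑ k, |y k|‖ := h1
    _ = δ / R * ‖∑ k, |y k|‖ := by rw [norm_smul, Real.norm_of_nonneg (by positivity)]
    _ ≤ δ / R * ∑ k, ‖y k‖ := by
        refine mul_le_mul_of_nonneg_left ((norm_sum_le _ _).trans_eq ?_) (by positivity)
        exact Finset.sum_congr rfl fun k _ => norm_abs_eq_norm _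
    _ < δ / R * R := mul_lt_mul_of_pos_left hy (by positivity)
    _ = δ := div_mul_cancel₀ _ hR.ne'

end Calculus

end

noncomputable section

/-! ### The completion of a normed vector lattice -/

section Completion

open UniformSpace

variable {Y : Type*} [NormedAddCommGroup Y] [Lattice Y] [IsOrderedAddMonoid Y] [HasSolidNorm Y]

theorem uniformContinuous₂_sup : UniformContinuous₂ (fun a b : Y => a ⊔ b) := by
  refine LipschitzWith.uniformContinuous (K := 2) (LipschitzWith.of_dist_le_mul fun p q => ?_)
  rw [dist_eq_norm, dist_eq_norm, NNReal.coe_ofNat, two_mul]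
  exact (norm_sup_sub_sup_le_add_norm _ _ _ _).trans
    (add_le_add (norm_fst_le (p - q)) (norm_snd_le (p - q)))

theorem uniformContinuous₂_inf : UniformContinuous₂ (fun a b : Y => a ⊓ b) := by
  refine LipschitzWith.uniformContinuous (K := 2) (LipschitzWith.of_dist_le_mul fun p q => ?_)
  rw [dist_eq_norm, dist_eq_norm, NNReal.coe_ofNat, two_mul]
  exact (norm_inf_sub_inf_le_add_norm _ _ _ _).trans
    (add_le_add (norm_fst_le (p - q)) (norm_snd_le (p - q)))

namespace UniformSpace.Completion

instance : Max (Completion Y) := ⟨Completion.map₂ (· ⊔ ·)⟩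

instance : Min (Completion Y) := ⟨Completion.map₂ (· ⊓ ·)⟩

theorem coe_sup (a b : Y) : ((a ⊔ b : Y) : Completion Y) = ↑a ⊔ ↑b :=
  (Completion.map₂_coe_coe a b _ uniformContinuous₂_sup).symm

theorem coe_inf (a b : Y) : ((a ⊓ b : Y) : Completion Y) = ↑a ⊓ ↑b :=
  (Completion.map₂_coe_coe a b _ uniformContinuous₂_inf).symm

omit [IsOrderedAddMonoid Y] [HasSolidNorm Y] in
theorem continuous_completion_sup {α : Type*} [TopologicalSpace α] {f g : α → Completion Y}
    (hf : Continuous f) (hg : Continuous g) : Continuous fun x => f x ⊔ g x :=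
  Completion.continuous_map₂ hf hg

omit [IsOrderedAddMonoid Y] [HasSolidNorm Y] in
theorem continuous_completion_inf {α : Type*} [TopologicalSpace α] {f g : α → Completion Y}
    (hf : Continuous f) (hg : Continuous g) : Continuous fun x => f x ⊓ g x :=
  Completion.continuous_map₂ hf hg

/-- The axioms are taken as identities for `⊔` and `⊓`: these are closed conditions, so they pass
from `Y` by density. -/
instance : Lattice (Completion Y) := Lattice.mk'
  (fun a b => Completion.induction_on₂ a b
    (isClosed_eq (continuous_completion_sup continuous_fst continuous_snd)
      (continuous_completion_sup continuous_snd continuous_fst))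
    fun a b => by rw [← coe_sup, ← coe_sup, sup_comm])
  (fun a b c => Completion.induction_on₃ a b c
    (isClosed_eq
      (continuous_completion_sup (continuous_completion_sup (by fun_prop) (by fun_prop))
        (by fun_prop))
      (continuous_completion_sup (by fun_prop) (continuous_completion_sup (by fun_prop)
        (by fun_prop))))
    fun a b c => by simp only [← coe_sup, sup_assoc])
  (fun a b => Completion.induction_on₂ a b
    (isClosed_eq (continuous_completion_inf continuous_fst continuous_snd)
      (continuous_completion_inf continuous_snd continuous_fst))
    fun a b => by rw [← coe_inf, ← coe_inf, inf_comm])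
  (fun a b c => Completion.induction_on₃ a b c
    (isClosed_eq
      (continuous_completion_inf (continuous_completion_inf (by fun_prop) (by fun_prop))
        (by fun_prop))
      (continuous_completion_inf (by fun_prop) (continuous_completion_inf (by fun_prop)
        (by fun_prop))))
    fun a b c => by simp only [← coe_inf, inf_assoc])
  (fun a b => Completion.induction_on₂ a b
    (isClosed_eq (continuous_completion_sup (by fun_prop)
      (continuous_completion_inf (by fun_prop) (by fun_prop))) (by fun_prop))
    fun a b => by rw [← coe_inf, ← coe_sup, sup_inf_self])
  (fun a b => Completion.induction_on₂ a b
    (isClosed_eq (continuous_completion_inf (by fun_prop)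
      (continuous_completion_sup (by fun_prop) (by fun_prop))) (by fun_prop))
    fun a b => by rw [← coe_sup, ← coe_inf, inf_sup_self])

theorem coe_abs (a : Y) : ((|a| : Y) : Completion Y) = |(a : Completion Y)| := by
  rw [abs, abs, coe_sup, Completion.coe_neg]

theorem continuous_completion_abs : Continuous fun a : Completion Y => |a| :=
  continuous_completion_sup continuous_id continuous_neg

theorem norm_abs (a : Completion Y) : ‖|a|‖ = ‖a‖ :=
  Completion.induction_on a (isClosed_eq continuous_completion_abs.norm continuous_norm)
    fun a => by rw [← coe_abs, Completion.norm_coe, Completion.norm_coe, norm_abs_eq_norm]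

/-- Solidity without its hypothesis: replacing `|b|` by `|a| ⊔ |b|` leaves a closed condition that
density can carry over. -/
theorem norm_le_norm_abs_sup_abs (a b : Completion Y) : ‖a‖ ≤ ‖|a| ⊔ |b|‖ :=
  Completion.induction_on₂ a b
    (isClosed_le continuous_fst.norm (continuous_completion_sup
      (continuous_completion_abs.comp continuous_fst)
      (continuous_completion_abs.comp continuous_snd)).norm)
    fun a b => by
      rw [← coe_abs, ← coe_abs, ← coe_sup, Completion.norm_coe, Completion.norm_coe]
      exact norm_le_norm_of_abs_le_abs (le_sup_left.trans (le_abs_self _))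

theorem add_sup_add_right (a b c : Completion Y) : (a + c) ⊔ (b + c) = a ⊔ b + c :=
  Completion.induction_on₃ a b c
    (isClosed_eq
      (continuous_completion_sup (continuous_fst.add (continuous_snd.comp continuous_snd))
        ((continuous_fst.comp continuous_snd).add (continuous_snd.comp continuous_snd)))
      ((continuous_completion_sup continuous_fst (continuous_fst.comp continuous_snd)).add
        (continuous_snd.comp continuous_snd)))
    fun a b c => by
      rw [← Completion.coe_add, ← Completion.coe_add, ← coe_sup, ← coe_sup,
        ← Completion.coe_add, sup_add]

variable [NormedSpace ℝ Y] [PosSMulMono ℝ Y]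

theorem smul_sup_smul {r : ℝ} (hr : 0 ≤ r) (a b : Completion Y) : r • a ⊔ r • b = r • (a ⊔ b) :=
  Completion.induction_on₂ a b
    (isClosed_eq
      (continuous_completion_sup (continuous_fst.const_smul r) (continuous_snd.const_smul r))
      ((continuous_completion_sup continuous_fst continuous_snd).const_smul r))
    fun a b => by
      rw [← Completion.coe_smul, ← Completion.coe_smul, ← coe_sup, ← coe_sup,
        ← Completion.coe_smul, smul_sup_of_nonneg hr]

instance : IsOrderedAddMonoid (Completion Y) where
  add_le_add_left a b h c := by rw [← sup_eq_right, add_sup_add_right, sup_eq_right.2 h]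

instance : PosSMulMono ℝ (Completion Y) where
  smul_le_smul_of_nonneg_left c hc a b h := by
    rw [← sup_eq_right, smul_sup_smul hc, sup_eq_right.2 h]

instance : HasSolidNorm (Completion Y) where
  solid a b h := by
    have := norm_le_norm_abs_sup_abs a b
    rwa [sup_eq_right.2 h, norm_abs] at this

instance : IsBanachLattice (Completion Y) where

end UniformSpace.Completion

end Completion

section ULift

variable {X : Type u} [NormedAddCommGroup X] [NormedSpace ℝ X] [Lattice X] [IsBanachLattice X]

/-- Lets `FBL^𝒟[E]` serve as a witness in a larger universe. -/
instance : IsBanachLattice (ULift.{v} X) where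
  add_le_add_left a b h c := by
    have h' : a.down ≤ b.down := h
    exact add_le_add_left h' c.down
  smul_le_smul_of_nonneg_left c hc a b h :=
    smul_le_smul_of_nonneg_left (b₁ := a.down) (b₂ := b.down) h hc
  solid a b h := norm_le_norm_of_abs_le_abs (a := a.down) (b := b.down) h

end ULift

/-! ### Convexity of Banach lattices containing `Y_0` densely -/

theorem posPart_sub_eq_self {X : Type*} [AddCommGroup X] [Lattice X] [IsOrderedAddMonoid X]
    {a b : X} (h : a ⊓ b = 0) : (a - b) ⊔ 0 = a := by
  have h1 := inf_add_sup a b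
  rw [h, zero_add] at h1
  have : (a - b) ⊔ 0 = a ⊔ b - b := by rw [sup_sub, sub_self]
  rw [this, h1, add_sub_cancel_right]

theorem inf_sum_eq_zero {X ι : Type*} [AddCommGroup X] [Lattice X] [IsOrderedAddMonoid X]
    {a : X} (ha : 0 ≤ a) {b : ι → X} (s : Finset ι) (hb : ∀ i ∈ s, 0 ≤ b i)
    (h : ∀ i ∈ s, a ⊓ b i = 0) : a ⊓ ∑ i ∈ s, b i = 0 := by
  classical
  induction s using Finset.induction_on with
  | empty => simpa using ha
  | insert i s hi ih =>
    rw [Finset.sum_insert hi]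
    have hs := ih (fun j hj => hb j (Finset.mem_insert_of_mem hj))
      (fun j hj => h j (Finset.mem_insert_of_mem hj))
    have hbi := hb i (Finset.mem_insert_self i s)
    have hsum : 0 ≤ ∑ i ∈ s, b i :=
      Finset.sum_nonneg fun j hj => hb j (Finset.mem_insert_of_mem hj)
    refine le_antisymm ?_ (le_inf ha (add_nonneg hbi hsum))
    -- On positive elements, `a ⊓ ·` is subadditive.
    have h1 : a ⊓ (b i + ∑ i ∈ s, b i) ≤ a ⊓ b i + a ⊓ ∑ i ∈ s, b i := by
      rw [inf_add, add_inf, add_inf]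
      refine le_inf (le_inf ?_ ?_) (le_inf ?_ inf_le_right)
      · exact inf_le_left.trans (le_add_of_nonneg_left ha)
      · exact inf_le_left.trans (le_add_of_nonneg_right hsum)
      · exact inf_le_left.trans (le_add_of_nonneg_left hbi)
    rwa [h i (Finset.mem_insert_self i s), hs, add_zero] at h1

/-- The disjointification of a tuple. -/
def disjointify {X : Type*} [AddCommGroup X] [Lattice X] {m : ℕ} (a : Fin m → X) (i : Fin m) : X :=
  ((a i ⊔ 0) - ∑ j ∈ Finset.univ.erase i, (a j ⊔ 0)) ⊔ 0

section Disjointify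

variable {X : Type*} [AddCommGroup X] [Lattice X] {m : ℕ}

theorem disjointify_nonneg (a : Fin m → X) (i : Fin m) : 0 ≤ disjointify a i := le_sup_right

theorem map_disjointify {Y : Type*} [AddCommGroup Y] [Lattice Y] [Module ℝ X] [Module ℝ Y]
    {T : X →ₗ[ℝ] Y} (hT : IsLatticeHom T) (a : Fin m → X) (i : Fin m) :
    T (disjointify a i) = disjointify (fun j => T (a j)) i := by
  simp only [disjointify, hT.1, map_sub, map_sum, map_zero]

variable [IsOrderedAddMonoid X]

theorem disjointify_inf_eq_zero (a : Fin m → X) {i j : Fin m} (hij : i ≠ j) :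
    disjointify a i ⊓ disjointify a j = 0 := by
  -- The bounds for `(i, j)` and `(j, i)` are the positive and negative parts of one element, hence
  -- disjoint.
  have key : ∀ i j : Fin m, i ≠ j → disjointify a i ≤ ((a i ⊔ 0) - (a j ⊔ 0)) ⊔ 0 := by
    intro i j hij
    refine sup_le_sup_right (sub_le_sub_left ?_ _) 0
    exact Finset.single_le_sum (f := fun j => a j ⊔ 0) (fun _ _ => le_sup_right)
      (Finset.mem_erase.2 ⟨hij.symm, Finset.mem_univ j⟩)
  refine le_antisymm ((inf_le_inf (key i j hij) (key j i hij.symm)).trans ?_)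
    (le_inf le_sup_right le_sup_right)
  rw [← neg_sub (a i ⊔ 0) (a j ⊔ 0)]
  exact (posPart_inf_negPart_eq_zero ((a i ⊔ 0) - (a j ⊔ 0))).le

theorem disjointify_eq_self {a : Fin m → X} (ha : ∀ i, 0 ≤ a i)
    (h : ∀ i j, i ≠ j → a i ⊓ a j = 0) : disjointify a = a := by
  funext i
  simp only [disjointify, fun i => sup_eq_left.2 (ha i)]
  exact posPart_sub_eq_self (inf_sum_eq_zero (ha i) _ (fun j _ => ha j)
    fun j hj => h i j (Finset.ne_of_mem_erase hj).symm)

end Disjointify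

namespace PreFBL

variable {E : Type u} [NormedAddCommGroup E] [NormedSpace ℝ E] {D : ConvexityCondition}

instance : HasSolidNorm (PreFBL E D) :=
  ⟨fun _ _ h => ciSup_le fun ν => (ν.2.1 _ _ h).trans (le_norm ν.2 _)⟩

variable {X : Type*} [NormedAddCommGroup X] [NormedSpace ℝ X] [Lattice X] [IsBanachLattice X]

/-- Monotonicity of `g` gives `ν (g(f)) ≤ M g(ν f) ≤ M g(‖f‖)` for each admissible `ν`, and the
supremum may be taken on the left. -/
theorem norm_functionCalculus_le {T : PreFBL E D →ₗ[ℝ] X} (hT : IsLatticeHom T)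
    (hnorm : ∀ f, ‖T f‖ = ‖f‖) {m : ℕ} {g : posHomFun m}
    (hg : (⟨m, g⟩ : Σ m : ℕ, posHomFun m) ∈ D.G) (f : Fin m → PreFBL E D) (hf : ∀ i, 0 ≤ f i)
    (hdisj : D.theta ⟨_, hg⟩ = false → ∀ i j, i ≠ j → f i ⊓ f j = 0) :
    ‖functionCalculus (fun i => T (f i)) g‖ ≤ D.M ⟨_, hg⟩ * g.1 fun i => ‖T (f i)‖ := by
  have hinj : Function.Injective T := (injective_iff_map_eq_zero T).2 fun f h0 =>
    norm_eq_zero.1 (by rw [← hnorm, h0, norm_zero])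
  have hc := (isFunctionCalculus_functionCalculus fun i => T (f i)).unique
    ((isFunctionCalculus_calculus f).comp hT)
  rw [hc, LinearMap.comp_apply, hnorm]
  simp only [hnorm]
  refine ciSup_le fun ν => ?_
  obtain ⟨Φ, hΦ, hle⟩ := ν.2.2.1 m g hg f hf hdisj
  -- The calculus provided by the convexity of `ν` is the pointwise one: both are pushed into `X`,
  -- where calculi are unique, and `T` is injective.
  have heq := ((isFunctionCalculus_calculus f).comp hT).unique (hΦ.comp hT)
  rw [hinj (LinearMap.congr_fun heq g)]
  refine hle.trans (mul_le_mul_of_nonneg_left ?_ (zero_le_one.trans (D.one_le _)))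
  exact D.monotone _ hg _ _ (fun i => apply_nonneg ν.1 _) fun i => le_norm ν.2 _

/-- A Banach lattice in which `Y_0` embeds densely, isometrically and as a sublattice, is
`𝒟`-convex. -/
theorem isDConvexBanachLattice_of_denseRange {T : PreFBL E D →ₗ[ℝ] X} (hT : IsLatticeHom T)
    (hnorm : ∀ f, ‖T f‖ = ‖f‖) (hdense : DenseRange T) : IsDConvexBanachLattice D X := by
  intro m g hg x hx hdisj
  refine ⟨functionCalculus x, isFunctionCalculus_functionCalculus x, ?_⟩
  change ‖functionCalculus x g‖ ≤ D.M ⟨_, hg⟩ * g.1 fun i => ‖x i‖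
  have hrange : DenseRange fun (f : Fin m → PreFBL E D) i => T (f i) :=
    DenseRange.piMap fun _ => hdense
  have hclosed : IsClosed {y : Fin m → X |
      ‖functionCalculus y g‖ ≤ D.M ⟨_, hg⟩ * g.1 fun i => ‖y i‖} :=
    isClosed_le (continuous_functionCalculus g).norm
      (continuous_const.mul (g.2.1.comp (by fun_prop)))
  -- A continuous `F` fixing `x` and sending tuples from `Y_0` to tuples to which convexity applies
  -- lets the inequality at `F y` pass by density to `y = x`. `F` will be the disjointification if
  -- `ϑ(g) = 0` and the positive part otherwise.
  have main : ∀ F : (Fin m → X) → Fin m → X, Continuous F → F x = x →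
      (∀ f : Fin m → PreFBL E D, ∃ f' : Fin m → PreFBL E D, (∀ i, 0 ≤ f' i) ∧
        (D.theta ⟨_, hg⟩ = false → ∀ i j, i ≠ j → f' i ⊓ f' j = 0) ∧
        F (fun i => T (f i)) = fun i => T (f' i)) →
      ‖functionCalculus x g‖ ≤ D.M ⟨_, hg⟩ * g.1 fun i => ‖x i‖ := by
    intro F hF hFx hFT
    have := hrange.induction_on (p := fun y : Fin m → X =>
      ‖functionCalculus (F y) g‖ ≤ D.M ⟨_, hg⟩ * g.1 fun i => ‖F y i‖) x (hclosed.preimage hF)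
      fun f => by
        obtain ⟨f', h0, hd, heq⟩ := hFT f
        rw [heq]
        exact norm_functionCalculus_le hT hnorm hg f' h0 hd
    rwa [hFx] at this
  by_cases hθ : D.theta ⟨_, hg⟩ = false
  · refine main disjointify ?_ (disjointify_eq_self hx (hdisj hθ)) fun f =>
      ⟨disjointify f, disjointify_nonneg f, fun _ i j hij => disjointify_inf_eq_zero f hij, ?_⟩
    · refine continuous_pi fun i => ?_
      unfold disjointify
      fun_prop
    · exact funext fun i => (map_disjointify hT f i).symm
  · refine main (fun y i => y i ⊔ 0) (by fun_prop) (funext fun i => sup_eq_left.2 (hx i)) fun f =>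
      ⟨fun i => f i ⊔ 0, fun i => le_sup_right, fun h => absurd h hθ, ?_⟩
    exact funext fun i => by rw [hT.1, map_zero]

/-- A lattice homomorphism into a `𝒟`-convex Banach lattice which is bounded by `K` on the
functions `δ_x` is bounded by `K` for the `𝒟`-norm. -/
theorem norm_map_le (hX : IsDConvexBanachLattice D X) {T : PreFBL E D →ₗ[ℝ] X}
    (hT : IsLatticeHom T) {K : ℝ} (hK : 0 < K) (hTK : ∀ x, ‖T (delta D x)‖ ≤ K * ‖x‖)
    (f : PreFBL E D) : ‖T f‖ ≤ K * ‖f‖ := by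
  let ν : Seminorm ℝ (PreFBL E D) := K⁻¹.toNNReal • (normSeminorm ℝ X).comp T
  have hν : ∀ f, ν f = K⁻¹ * ‖T f‖ := fun f => by
    change (K⁻¹.toNNReal : ℝ) * ‖T f‖ = _
    rw [Real.coe_toNNReal _ (inv_nonneg.2 hK.le)]
  have hmem : ν ∈ admissible E D := by
    refine ⟨fun f g h => ?_, fun m g hg f hf hdisj => ?_, fun x => ?_⟩
    · rw [hν, hν]
      refine mul_le_mul_of_nonneg_left (norm_le_norm_of_abs_le_abs ?_) (inv_nonneg.2 hK.le)
      rw [← hT.map_abs, ← hT.map_abs]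
      exact hT.monotone h
    · refine ⟨calculus f, isFunctionCalculus_calculus f, ?_⟩
      obtain ⟨Φ, hΦ, hle⟩ := hX m g hg (fun i => T (f i))
        (fun i => by simpa using hT.monotone (hf i))
        fun hθ i j hij => by rw [← hT.2, hdisj hθ i j hij, map_zero]
      rw [hΦ.unique ((isFunctionCalculus_calculus f).comp hT)] at hle
      have hle : ‖T (calculus f g)‖ ≤ D.M ⟨_, hg⟩ * g.1 fun i => ‖T (f i)‖ := hle
      have h1 : (fun i => ν (f i)) = K⁻¹ • fun i => ‖T (f i)‖ := funext fun i => hν _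
      -- Positive homogeneity of `g` lets the factor `K⁻¹` cancel from both sides.
      rw [hν, h1, g.2.2 _ (inv_nonneg.2 hK.le), mul_left_comm]
      exact mul_le_mul_of_nonneg_left hle (inv_nonneg.2 hK.le)
    · rw [hν, inv_mul_le_iff₀ hK]
      exact hTK x
  have := le_norm hmem f
  rwa [hν, inv_mul_le_iff₀ hK] at this

end PreFBL

end

noncomputable section

/-! ### The two implications -/

section Main

variable {E : Type u} [NormedAddCommGroup E] [NormedSpace ℝ E]

/-- The identity of `E` factors through some `𝒟`-convex Banach lattice in the universe of `E`, or
in any larger one, as soon as `φ_E(E)` is complemented. -/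
theorem exists_factorization_of_isComplementedWith (D : ConvexityCondition) {C : ℝ}
    (h : IsComplementedWith C (LinearMap.range (FBL.phi E D).toLinearMap)) :
    ∃ (X : Type (max u v)) (_ : NormedAddCommGroup X) (_ : NormedSpace ℝ X) (_ : Lattice X)
      (_ : IsBanachLattice X), IsDConvexBanachLattice D X ∧ IsIsomorphicToComplemented C E X := by
  obtain ⟨P, hP, hPC⟩ := h
  let L : ULift.{v} (FBL E D) ≃ₗᵢ[ℝ] FBL E D := ⟨ULift.moduleEquiv, fun _ => rfl⟩
  let J : FBL E D →ₗᵢ[ℝ] ULift.{v} (FBL E D) := L.symm.toLinearIsometry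
  let ι : PreFBL E D →ₗᵢ[ℝ] ULift.{v} (FBL E D) :=
    J.comp (UniformSpace.Completion.toComplₗᵢ (𝕜 := ℝ) (E := PreFBL E D))
  refine ⟨ULift.{v} (FBL E D), inferInstance, inferInstance, inferInstance, inferInstance, ?_, ?_⟩
  · refine PreFBL.isDConvexBanachLattice_of_denseRange (T := ι.toLinearMap)
      (IsLatticeHom.of_map_sup fun a b =>
        congrArg ULift.up (UniformSpace.Completion.coe_sup a b)) ι.norm_map ?_
    exact L.symm.surjective.denseRange.comp UniformSpace.Completion.denseRange_coe
      L.symm.continuous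
  · let e := (FBL.phi E D).equivRange
    refine ⟨(J.comp (FBL.phi E D)).toContinuousLinearMap,
      (e.symm.toLinearIsometry.toContinuousLinearMap.comp P).comp
        L.toLinearIsometry.toContinuousLinearMap, ?_, ?_⟩
    · ext x
      change e.symm (P (FBL.phi E D x)) = x
      rw [LinearIsometryEquiv.symm_apply_eq]
      exact hP (e x)
    · have h1 := (J.comp (FBL.phi E D)).norm_toContinuousLinearMap_le
      have h2 : ‖(e.symm.toLinearIsometry.toContinuousLinearMap.comp P).comp
          L.toLinearIsometry.toContinuousLinearMap‖ ≤ ‖P‖ := by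
        refine ContinuousLinearMap.opNorm_le_bound _ P.opNorm_nonneg fun y => ?_
        change ‖e.symm (P (L y))‖ ≤ _
        rw [e.symm.norm_map, ← L.norm_map y]
        exact P.le_opNorm _
      exact (mul_le_of_le_one_left (norm_nonneg _) h1).trans (h2.trans hPC)

variable {X : Type*} [NormedAddCommGroup X] [NormedSpace ℝ X] [Lattice X] [IsBanachLattice X]

theorem isComplementedWith_of_factorization [CompleteSpace E] {D : ConvexityCondition} {C : ℝ}
    (hC : 0 ≤ C) (hX : IsDConvexBanachLattice D X) (h : IsIsomorphicToComplemented C E X) :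
    IsComplementedWith C (LinearMap.range (FBL.phi E D).toLinearMap) := by
  obtain ⟨U, V, hVU, hUV⟩ := h
  have hVU' : ∀ x, V (U x) = x := fun x => congrArg (fun A : E →L[ℝ] E => A x) hVU
  -- If `U = 0` then `E = 0`; this case is separate because the seminorm `‖U‖⁻¹ ‖T ·‖` requires `‖U‖
  -- > 0`.
  rcases (norm_nonneg U).eq_or_lt with hU | hU
  · have hE : ∀ x : E, x = 0 := fun x => by
      rw [← hVU' x, norm_eq_zero.1 hU.symm]
      simp
    refine ⟨0, ?_, ContinuousLinearMap.opNorm_zero.trans_le hC⟩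
    rintro ⟨_, x, rfl⟩
    refine Subtype.ext ?_
    rw [hE x]
    simp
  · obtain ⟨T, hT, hTU⟩ := PreFBL.exists_latticeHom D U.toLinearMap
    have hTU : ∀ x, T (PreFBL.delta D x) = U x := hTU
    have hTle := PreFBL.norm_map_le hX hT hU fun x => by
      rw [hTU]
      exact U.le_opNorm x
    let S : PreFBL E D →L[ℝ] E := V.comp (T.mkContinuous ‖U‖ hTle)
    have hS : ‖S‖ ≤ C := by
      refine (V.opNorm_comp_le _).trans (le_trans ?_ hUV)
      rw [mul_comm]
      exact mul_le_mul_of_nonneg_right (T.mkContinuous_norm_le hU.le hTle) (norm_nonneg V)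
    let ι := UniformSpace.Completion.toComplL (𝕜 := ℝ) (E := PreFBL E D)
    let Sext : FBL E D →L[ℝ] E := S.extend ι
    have hext : ∀ f : PreFBL E D, Sext (f : FBL E D) = S f := fun f =>
      S.extend_eq UniformSpace.Completion.denseRange_coe
        (UniformSpace.Completion.isUniformInducing_coe _) f
    have hSext : ∀ y, ‖Sext y‖ ≤ C * ‖y‖ := fun y =>
      UniformSpace.Completion.induction_on y
        (isClosed_le Sext.continuous.norm (continuous_const.mul continuous_norm)) fun f => by
          rw [hext, UniformSpace.Completion.norm_coe]
          exact S.le_of_opNorm_le hS f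
    let e := (FBL.phi E D).equivRange
    -- As `φ_E` is isometric, following the extension of `V T` by it does not increase the norm.
    refine ⟨e.toLinearIsometry.toContinuousLinearMap.comp Sext, ?_, ?_⟩
    · rintro ⟨_, x, rfl⟩
      change e (Sext ((PreFBL.delta D x : PreFBL E D) : FBL E D)) = e x
      rw [hext]
      change e (V (T (PreFBL.delta D x))) = e x
      rw [hTU, hVU']
    · refine ContinuousLinearMap.opNorm_le_bound _ hC fun y => ?_
      exact (e.norm_map _).trans_le (hSext y)

end Main

end

theorem proposition4p2 {E : Type u} [NormedAddCommGroup E] [NormedSpace ℝ E] [CompleteSpace E]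
    (D : ConvexityCondition) (C : ℝ) (hC : 1 ≤ C) :
    (∃ (X : Type (max u v)) (_ : NormedAddCommGroup X) (_ : NormedSpace ℝ X) (_ : Lattice X)
        (_ : IsBanachLattice X),
        IsDConvexBanachLattice D X ∧ IsIsomorphicToComplemented C E X) ↔
      IsComplementedWith C (LinearMap.range (FBL.phi E D).toLinearMap) := by
  refine ⟨?_, exists_factorization_of_isComplementedWith.{u, v} D⟩
  rintro ⟨X, _, _, _, _, hX, h⟩
  exact isComplementedWith_of_factorization (zero_le_one.trans hC) hX h
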